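/- Let $R$ be a commutative ring, let $\underline{x} = x_1,\ldots,x_k$ be an ordered sequence of elements of $R$, and let $M$ be an $R$-module. For a positive integer $n$ put $\underline{x}^{(n)} = x_1^n,\ldots,x_k^n$; for a submodule $N \subseteq M$ and $r \in R$ put $N :_M r = \{a \in M : ra \in N\}$. The sequence $\underline{x}$ is called *$M$-proregular* if for all $i = 1,\ldots,k$ and every positive integer $n$ there is an integer $m \ge n$ such that $$(x_1^m,\ldots,x_{i-1}^m)M :_M x_i^m \;\subseteq\; (x_1^n,\ldots,x_{i-1}^n)M :_M x_i^{m-n},$$ equivalently, such that multiplication by $x_i^{m-n}$ induces the zero map $$\bigl((x_1^m,\ldots,x_{i-1}^m)M :_M x_i^m\bigr)/(x_1^m,\ldots,x_{i-1}^m)M \to \bigl((x_1^n,\ldots,x_{i-1}^n)M :_M x_i^n\bigr)/(x_1^n,\ldots,x_{i-1}^n)M.$$ The sequence $\underline{x}$ is called *$M$-weakly proregular* if for all $i > 0$ and every positive integer $n$ there is an integer $m \ge n$ such that the natural homomorphism of Koszul homology modules $$H_i(\underline{x}^{(m)};M) \to H_i(\underline{x}^{(n)};M),$$ induced by the morphism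 of Koszul complexes $K_\bullet(\underline{x}^{(m)};M) \to K_\bullet(\underline{x}^{(n)};M)$, $e_{j_1}\wedge\cdots\wedge e_{j_p} \mapsto (x_{j_1}\cdots x_{j_p})^{m-n}\, e_{j_1}\wedge\cdots\wedge e_{j_p}$, is zero. **Theorem.** If $\underline{x}$ is $M$-proregular, then $\underline{x}$ is $M$-weakly proregular. -/

import Mathlib

open CategoryTheory

noncomputable section

namespace Koszul

universe u v

variable {R : Type u} [CommRing R]

/-- The submodule `N :_M r = {a ∈ M | r a ∈ N}` of `M`. -/
def colon {M : Type v} [AddCommGroup M] [Module R M] (N : Submodule R M) (r : R) :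
    Submodule R M :=
  N.comap (LinearMap.lsmul R M r)

/-- The submodule `(x_1^n, …, x_{i-1}^n) M` of `M`: the ideal generated by the `n`-th powers of
the elements strictly before position `i`, times `M`. -/
def initialPowers (M : Type v) [AddCommGroup M] [Module R M] {k : ℕ} (x : Fin k → R)
    (i : Fin k) (n : ℕ) : Submodule R M :=
  Ideal.span {r : R | ∃ j : Fin k, j < i ∧ r = x j ^ n} • (⊤ : Submodule R M)

/-- The sequence `x` is `M`-proregular: for all `i` and all `n ≥ 1` there is an `m ≥ n` with
`(x_1^m, …, x_{i-1}^m)M :_M x_i^m ⊆ (x_1^n, …, x_{i-1}^n)M :_M x_i^{m-n}`, that is, such that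
multiplication by `x_i^{m-n}` from
`((x_1^m, …, x_{i-1}^m)M :_M x_i^m) / (x_1^m, …, x_{i-1}^m)M` to
`((x_1^n, …, x_{i-1}^n)M :_M x_i^n) / (x_1^n, …, x_{i-1}^n)M` is the zero map. -/
def IsProregular (M : Type v) [AddCommGroup M] [Module R M] {k : ℕ} (x : Fin k → R) : Prop :=
  ∀ i : Fin k, ∀ n : ℕ, 1 ≤ n → ∃ m : ℕ, n ≤ m ∧
    colon (initialPowers M x i m) (x i ^ m) ≤ colon (initialPowers M x i n) (x i ^ (m - n))

/-- The degree `p` part `K_p(x; M) = ⨁_S M e_S` of the Koszul complex, `S` running over the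
subsets of the index set with `p` elements. A function `f` stands for `∑_S f(S) e_S`, where
`e_S = e_{j_1} ∧ ⋯ ∧ e_{j_p}` for `S = {j_1 < ⋯ < j_p}`. -/
abbrev Chains (k p : ℕ) (M : Type v) : Type v :=
  {S : Finset (Fin k) // S.card = p} → M

/-- `S ∪ {j}` for `j ∉ S`. -/
def adjoin {k p : ℕ} (S : {S : Finset (Fin k) // S.card = p}) (j : {j : Fin k // j ∉ S.1}) :
    {S : Finset (Fin k) // S.card = p + 1} :=
  ⟨insert j.1 S.1, by rw [Finset.card_insert_of_notMem j.2, S.2]⟩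

/-- The number of elements of `S` that precede `j`. -/
def before {k : ℕ} (S : Finset (Fin k)) (j : Fin k) : ℕ := (S.filter (· < j)).card

/-- The Koszul differential `K_{p+1}(x; M) → K_p(x; M)`,
`e_{j_0} ∧ ⋯ ∧ e_{j_p} ↦ ∑_s (-1)^s x_{j_s} e_{j_0} ∧ ⋯ ∧ (omit e_{j_s}) ∧ ⋯ ∧ e_{j_p}`:
the coefficient of `e_S` in the image of `f` collects the terms coming from `e_{S ∪ {j}}`,
`j ∉ S`. -/
def differential (M : Type v) [AddCommGroup M] [Module R M] {k : ℕ} (x : Fin k → R) (p : ℕ) :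
    Chains k (p + 1) M →ₗ[R] Chains k p M where
  toFun f := fun S => ∑ j : {j : Fin k // j ∉ S.1},
    ((-1 : R) ^ before S.1 j.1 * x j.1) • f (adjoin S j)
  map_add' f g := by
    funext S
    simp [Finset.sum_add_distrib]
  map_smul' r f := by
    funext S
    simp only [Pi.smul_apply, RingHom.id_apply, Finset.smul_sum]
    refine Finset.sum_congr rfl fun j _ => ?_
    rw [smul_smul, smul_smul, mul_comm]

theorem before_insert {k : ℕ} (S : Finset (Fin k)) {j l : Fin k} (hj : j ∉ S) :
    before (insert j S) l = before S l + if j < l then 1 else 0 := by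
  unfold before
  rw [Finset.filter_insert]
  split_ifs with h
  · rw [Finset.card_insert_of_notMem (by simp [hj])]
  · rfl

theorem differential_comp (M : Type v) [AddCommGroup M] [Module R M] {k : ℕ} (x : Fin k → R)
    (p : ℕ) : differential M x p ∘ₗ differential M x (p + 1) = 0 := by
  refine LinearMap.ext fun f => ?_
  funext S
  simp only [LinearMap.comp_apply, differential, LinearMap.coe_mk, AddHom.coe_mk,
    LinearMap.zero_apply, Pi.zero_apply, Finset.smul_sum]
  rw [Finset.sum_sigma']
  have mem : ∀ a : (j : {j : Fin k // j ∉ S.1}) × {l : Fin k // l ∉ (adjoin S j).1},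
      a.2.1 ≠ a.1.1 ∧ a.2.1 ∉ S.1 := by
    intro a
    have h := a.2.2
    simpa [adjoin] using h
  refine Finset.sum_involution
    (fun a _ => ⟨⟨a.2.1, (mem a).2⟩, ⟨a.1.1, by
      simpa [adjoin] using And.intro (mem a).1.symm a.1.2⟩⟩) ?_ ?_ ?_ ?_
  · rintro a -
    obtain ⟨hne, hS⟩ := mem a
    obtain ⟨⟨j, hj⟩, ⟨l, hl⟩⟩ := a
    dsimp only at hne hS ⊢
    have e : adjoin (adjoin S ⟨l, hS⟩) ⟨j, by simpa [adjoin] using And.intro hne.symm hj⟩ =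
        adjoin (adjoin S ⟨j, hj⟩) ⟨l, hl⟩ := Subtype.ext (Finset.insert_comm _ _ _)
    rw [e, smul_smul, smul_smul, ← add_smul]
    convert zero_smul R _
    change (-1 : R) ^ before S.1 j * x j * ((-1) ^ before (insert j S.1) l * x l) +
      (-1 : R) ^ before S.1 l * x l * ((-1) ^ before (insert l S.1) j * x j) = 0
    rw [before_insert _ hj, before_insert _ hS]
    rcases lt_or_gt_of_ne hne with h | h
    · rw [if_neg h.asymm, if_pos h]; ring
    · rw [if_pos h, if_neg h.asymm]; ring
  · rintro a - - h
    exact (mem a).1 (congrArg (fun b => b.1.1) h)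
  · intro a _
    exact Finset.mem_univ _
  · intro a _
    rfl

/-- The Koszul complex `K_•(x; M)`. -/
def complex (M : Type v) [AddCommGroup M] [Module R M] {k : ℕ} (x : Fin k → R) :
    ChainComplex (ModuleCat.{v} R) ℕ :=
  ChainComplex.of (fun p => ModuleCat.of R (Chains k p M))
    (fun p => ModuleCat.ofHom (differential M x p))
    (fun p => by
      rw [← ModuleCat.ofHom_comp, differential_comp]
      rfl)

/-- The map `e_S ↦ (∏_{j ∈ S} a_j) e_S` in degree `p`. -/
def scale (M : Type v) [AddCommGroup M] [Module R M] {k : ℕ} (a : Fin k → R) (p : ℕ) :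
    Chains k p M →ₗ[R] Chains k p M :=
  LinearMap.pi fun S => (∏ j ∈ S.1, a j) • LinearMap.proj S

theorem scale_comm (M : Type v) [AddCommGroup M] [Module R M] {k : ℕ} (x y a : Fin k → R)
    (h : ∀ j, x j = a j * y j) (p : ℕ) :
    differential M y p ∘ₗ scale M a (p + 1) = scale M a p ∘ₗ differential M x p := by
  refine LinearMap.ext fun f => ?_
  funext S
  simp only [LinearMap.comp_apply, differential, scale, LinearMap.coe_mk, AddHom.coe_mk,
    LinearMap.pi_apply, LinearMap.smul_apply, LinearMap.proj_apply, Finset.smul_sum]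
  refine Finset.sum_congr rfl fun j _ => ?_
  have e : ∏ i ∈ (adjoin S j).1, a i = a j.1 * ∏ i ∈ S.1, a i := Finset.prod_insert j.2
  rw [e, smul_smul, smul_smul, h]
  congr 1
  ring

/-- The natural morphism `K_•(x; M) → K_•(y; M)` for `x_j = a_j y_j`: it is the identity in
degree `0`, and is induced by `e_j ↦ a_j e_j`. -/
def complexMap (M : Type v) [AddCommGroup M] [Module R M] {k : ℕ} (x y a : Fin k → R)
    (h : ∀ j, x j = a j * y j) : complex M x ⟶ complex M y :=
  ChainComplex.ofHom (fun p => ModuleCat.ofHom (scale M a p)) (fun p => by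
    simp only [complex, ChainComplex.of_d]
    exact congrArg ModuleCat.ofHom (scale_comm M x y a h p))

/-- The sequence `x^{(n)} = x_1^n, …, x_k^n`. -/
def powers {k : ℕ} (x : Fin k → R) (n : ℕ) : Fin k → R := fun j => x j ^ n

/-- The natural morphism `K_•(x^{(m)}; M) → K_•(x^{(n)}; M)` for `m ≥ n`, induced by
`e_j ↦ x_j^{m-n} e_j`. -/
def transition (M : Type v) [AddCommGroup M] [Module R M] {k : ℕ} (x : Fin k → R) {m n : ℕ}
    (h : n ≤ m) : complex M (powers x m) ⟶ complex M (powers x n) :=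
  complexMap M (powers x m) (powers x n) (powers x (m - n)) fun j => by
    simp only [powers]
    rw [← pow_add, Nat.sub_add_cancel h]

/-- The sequence `x` is `M`-weakly proregular: for all `i > 0` and all `n ≥ 1` there is an
`m ≥ n` such that the natural map `H_i(x^{(m)}; M) → H_i(x^{(n)}; M)` is zero. -/
def IsWeaklyProregular (M : Type v) [AddCommGroup M] [Module R M] {k : ℕ} (x : Fin k → R) :
    Prop :=
  ∀ i : ℕ, 0 < i → ∀ n : ℕ, 1 ≤ n → ∃ (m : ℕ) (h : n ≤ m),
    HomologicalComplex.homologyMap (transition M x h) i = 0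

end Koszul

end

noncomputable section

namespace Koszul

universe u v

variable {R : Type u} [CommRing R] {M : Type v} [AddCommGroup M] [Module R M] {k : ℕ}

/-! Induction on the number `i` of initial elements, for all degrees and exponents at once. The
complex on `i + 1` elements is an extension, with the complex on `i` elements as subcomplex and its
shift, the coefficients of `∧ e_i`, as quotient. A transition that is zero on homology of the
quotient, followed by one that is zero on homology of the subcomplex, is zero in the middle; hence
an intermediate exponent `l` with `n ≤ l ≤ m`.

In positive degree the quotient is handled by induction. In degree `0` the contraction of a cycle is
an element of `(x_1^m, …)M : x_i^m`, and proregularity makes its multiple by `x_i^{m-l}` a boundary.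
The carrying lemmas are `contract_totalDifferential`, `sub_totalDifferential_wedge_mem_supported`
and `exists_totalDifferential_eq`.

Chains are functions on all finite subsets, so that inserting and erasing an index needs no
cardinality proofs. -/

/-- The differential of the Koszul complex on inhomogeneous chains. -/
def totalDifferential (M : Type v) [AddCommGroup M] [Module R M] (x : Fin k → R) :
    (Finset (Fin k) → M) →ₗ[R] (Finset (Fin k) → M) :=
  LinearMap.pi fun S => ∑ j : {j : Fin k // j ∉ S},
    ((-1 : R) ^ before S j.1 * x j.1) • LinearMap.proj (insert j.1 S)

theorem totalDifferential_apply (x : Fin k → R) (f : Finset (Fin k) → M) (S : Finset (Fin k)) :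
    totalDifferential M x f S = ∑ j : {j : Fin k // j ∉ S},
      ((-1 : R) ^ before S j.1 * x j.1) • f (insert j.1 S) := by
  simp [totalDifferential]

/-- The map `e_S ↦ (∏_{j ∈ S} a_j) e_S` on inhomogeneous chains. -/
def totalScale (M : Type v) [AddCommGroup M] [Module R M] (a : Fin k → R) :
    (Finset (Fin k) → M) →ₗ[R] (Finset (Fin k) → M) :=
  LinearMap.pi fun S => (∏ j ∈ S, a j) • LinearMap.proj S

theorem totalScale_apply (a : Fin k → R) (f : Finset (Fin k) → M) (S : Finset (Fin k)) :
    totalScale M a f S = (∏ j ∈ S, a j) • f S := rfl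

theorem totalScale_totalScale (a b : Fin k → R) (f : Finset (Fin k) → M) :
    totalScale M a (totalScale M b f) = totalScale M (fun j => a j * b j) f := by
  funext S
  simp only [totalScale_apply, smul_smul, Finset.prod_mul_distrib]

/-- The homogeneous component of degree `p` of a chain. -/
def component (p : ℕ) (f : Finset (Fin k) → M) : Chains k p M := fun S => f S.1

theorem component_totalDifferential (x : Fin k → R) (p : ℕ) (f : Finset (Fin k) → M) :
    component p (totalDifferential M x f) = differential M x p (component (p + 1) f) := by
  funext S
  exact totalDifferential_apply x f S.1

theorem component_totalScale (a : Fin k → R) (p : ℕ) (f : Finset (Fin k) → M) :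
    component p (totalScale M a f) = scale M a p (component p f) := rfl

theorem ext_component {A : Type v} {f g : Finset (Fin k) → A} (h : ∀ p, component p f = component p g) :
    f = g :=
  funext fun S => congrFun (h S.card) ⟨S, rfl⟩

theorem totalDifferential_totalDifferential (x : Fin k → R) (f : Finset (Fin k) → M) :
    totalDifferential M x (totalDifferential M x f) = 0 := by
  refine ext_component fun p => ?_
  rw [component_totalDifferential, component_totalDifferential]
  exact LinearMap.congr_fun (differential_comp M x p) _

theorem totalDifferential_totalScale (x y a : Fin k → R) (h : ∀ j, x j = a j * y j)
    (f : Finset (Fin k) → M) :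
    totalDifferential M y (totalScale M a f) = totalScale M a (totalDifferential M x f) := by
  refine ext_component fun p => ?_
  rw [component_totalDifferential, component_totalScale, component_totalScale,
    component_totalDifferential]
  exact LinearMap.congr_fun (scale_comm M x y a h p) _

/-! ### Initial segments, and splitting off the last element -/

/-- The chains of degree `p` on the first `i` elements of the sequence. -/
def supported (R : Type u) [CommRing R] (M : Type v) [AddCommGroup M] [Module R M] (k i p : ℕ) :
    Submodule R (Finset (Fin k) → M) where
  carrier := {f | ∀ S : Finset (Fin k), ¬(S.card = p ∧ ∀ j ∈ S, j.val < i) → f S = 0}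
  add_mem' hf hg S hS := by rw [Pi.add_apply, hf S hS, hg S hS, add_zero]
  zero_mem' _ _ := rfl
  smul_mem' r f hf S hS := by rw [Pi.smul_apply, hf S hS, smul_zero]

theorem supported_mono {i i' p : ℕ} (h : i ≤ i') : supported R M k i p ≤ supported R M k i' p :=
  fun _ hf S hS => hf S fun hS' => hS ⟨hS'.1, fun j hj => (hS'.2 j hj).trans_le h⟩

theorem totalScale_mem_supported (a : Fin k → R) {i p : ℕ} {f : Finset (Fin k) → M}
    (hf : f ∈ supported R M k i p) : totalScale M a f ∈ supported R M k i p := fun S hS => by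
  rw [totalScale_apply, hf S hS, smul_zero]

theorem totalDifferential_mem_supported (x : Fin k → R) {i p : ℕ} {f : Finset (Fin k) → M}
    (hf : f ∈ supported R M k i (p + 1)) : totalDifferential M x f ∈ supported R M k i p := by
  intro S hS
  rw [totalDifferential_apply]
  refine Finset.sum_eq_zero fun j _ => ?_
  rw [hf, smul_zero]
  rintro ⟨hc, hlt⟩
  rw [Finset.card_insert_of_notMem j.2] at hc
  exact hS ⟨Nat.succ_injective hc, fun l hl => hlt l (Finset.mem_insert_of_mem hl)⟩

/-- The coefficient of `∧ e_i` in a chain: `e_S ∧ e_i ↦ e_S`. -/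
def contract (R : Type u) [CommRing R] (M : Type v) [AddCommGroup M] [Module R M] (i : Fin k) :
    (Finset (Fin k) → M) →ₗ[R] (Finset (Fin k) → M) where
  toFun f S := if i ∈ S then 0 else f (insert i S)
  map_add' f g := by
    funext S
    by_cases h : i ∈ S <;> simp [h]
  map_smul' r f := by
    funext S
    by_cases h : i ∈ S <;> simp [h]

theorem contract_apply (i : Fin k) (f : Finset (Fin k) → M) (S : Finset (Fin k)) :
    contract R M i f S = if i ∈ S then 0 else f (insert i S) := rfl

/-- The chain `f ∧ e_i`, for `f` a chain on the elements that precede `i`. -/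
def wedge (i : Fin k) (f : Finset (Fin k) → M) : Finset (Fin k) → M :=
  fun S => if i ∈ S then f (S.erase i) else 0

theorem contract_mem_supported (i : Fin k) {p : ℕ} {f : Finset (Fin k) → M}
    (hf : f ∈ supported R M k (i + 1) (p + 1)) : contract R M i f ∈ supported R M k i p := by
  intro S hS
  rw [contract_apply]
  split_ifs with h
  · rfl
  · refine hf _ ?_
    rintro ⟨hc, hlt⟩
    rw [Finset.card_insert_of_notMem h] at hc
    refine hS ⟨Nat.succ_injective hc, fun l hl => ?_⟩
    have h1 := hlt l (Finset.mem_insert_of_mem hl)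
    have h2 : l.val ≠ i.val := fun e => h (Fin.ext e ▸ hl)
    omega

theorem wedge_mem_supported (i : Fin k) {p : ℕ} {f : Finset (Fin k) → M}
    (hf : f ∈ supported R M k i p) : wedge i f ∈ supported R M k (i + 1) (p + 1) := by
  intro S hS
  unfold wedge
  split_ifs with h
  · refine hf _ ?_
    rintro ⟨hc, hlt⟩
    refine hS ⟨by rw [← Finset.card_erase_add_one h, hc], fun l hl => ?_⟩
    by_cases e : l = i
    · rw [e]; omega
    · exact (hlt l (Finset.mem_erase.2 ⟨e, hl⟩)).trans (Nat.lt_succ_self _)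
  · rfl

theorem contract_wedge (i : Fin k) {p : ℕ} {f : Finset (Fin k) → M}
    (hf : f ∈ supported R M k i p) : contract R M i (wedge i f) = f := by
  funext S
  rw [contract_apply]
  split_ifs with h
  · exact (hf S fun hS => lt_irrefl _ (hS.2 i h)).symm
  · simp [wedge, Finset.erase_insert h]

theorem mem_supported_of_contract_eq_zero (i : Fin k) {p : ℕ} {f : Finset (Fin k) → M}
    (hf : f ∈ supported R M k (i + 1) p) (h : contract R M i f = 0) :
    f ∈ supported R M k i p := by
  intro S hS
  by_cases hi : i ∈ S
  · have := congrFun h (S.erase i)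
    rwa [contract_apply, if_neg (Finset.notMem_erase i S), Finset.insert_erase hi] at this
  · refine hf S fun hS' => hS ⟨hS'.1, fun l hl => ?_⟩
    have h1 := hS'.2 l hl
    have h2 : l.val ≠ i.val := fun e => hi (Fin.ext e ▸ hl)
    omega

theorem contract_totalScale (i : Fin k) (a : Fin k → R) (f : Finset (Fin k) → M) :
    contract R M i (totalScale M a f) = a i • totalScale M a (contract R M i f) := by
  funext S
  simp only [contract_apply, totalScale_apply, Pi.smul_apply]
  split_ifs with h
  · simp
  · rw [Finset.prod_insert h, mul_smul]

/-- No sign appears because `e_i` is the last factor: the sign of removing `e_j` counts only the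
indices before `j`, so for `j < i` it ignores `i`. Terms with `j > i` vanish by the support
condition. -/
theorem contract_totalDifferential (i : Fin k) (x : Fin k → R) {p : ℕ}
    {f : Finset (Fin k) → M} (hf : f ∈ supported R M k (i + 1) p) :
    contract R M i (totalDifferential M x f) = totalDifferential M x (contract R M i f) := by
  have zero_of_lt : ∀ (S : Finset (Fin k)) (j : Fin k), i < j → j ∈ S → f S = 0 :=
    fun S j hij hj => hf S fun hS => by
      have := hS.2 j hj
      have : i.val < j.val := hij
      omega
  funext S
  rw [contract_apply]
  split_ifs with h
  · rw [totalDifferential_apply]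
    refine (Finset.sum_eq_zero fun j _ => ?_).symm
    rw [contract_apply, if_pos (Finset.mem_insert_of_mem h), smul_zero]
  · rw [totalDifferential_apply, totalDifferential_apply]
    have term (j : Fin k) (hj : j ∉ insert i S) :
        ((-1 : R) ^ before (insert i S) j * x j) • f (insert j (insert i S)) =
          ((-1 : R) ^ before S j * x j) • contract R M i f (insert j S) := by
      obtain ⟨hji, hjS⟩ : j ≠ i ∧ j ∉ S := by simpa using hj
      rw [contract_apply, if_neg (by simp [hji.symm, h]), Finset.insert_comm i j S]
      rcases lt_or_gt_of_ne hji with hlt | hgt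
      · rw [before_insert _ h, if_neg hlt.asymm, add_zero]
      · rw [zero_of_lt _ j hgt (Finset.mem_insert_self _ _), smul_zero, smul_zero]
    rw [← Finset.sum_subtype (M := M) (p := (· ∉ insert i S)) (insert i S)ᶜ (by simp)
        (fun j : Fin k => ((-1 : R) ^ before (insert i S) j * x j) • f (insert j (insert i S))),
      ← Finset.sum_subtype (M := M) (p := (· ∉ S)) Sᶜ (by simp)
        (fun j : Fin k => ((-1 : R) ^ before S j * x j) • contract R M i f (insert j S)),
      Finset.sum_congr rfl fun j hj => term j (Finset.mem_compl.1 hj)]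
    -- The only extra index on the right is `j = i`, where the contraction is zero.
    refine Finset.sum_subset (Finset.compl_subset_compl.2 (Finset.subset_insert i S)) ?_
    intro j hjS hj
    obtain rfl : j = i := by
      by_contra hne
      exact hj (by simpa [hne] using hjS)
    rw [contract_apply, if_pos (Finset.mem_insert_self _ _), smul_zero]

/-- If the contraction of a chain is a boundary, then the chain is homologous to one on the
preceding elements. -/
theorem sub_totalDifferential_wedge_mem_supported (i : Fin k) (x : Fin k → R) {p : ℕ} {z w : Finset (Fin k) → M}
    (hz : z ∈ supported R M k (i + 1) p) (hw : w ∈ supported R M k i p)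
    (h : totalDifferential M x w = contract R M i z) :
    z - totalDifferential M x (wedge i w) ∈ supported R M k i p := by
  have hw' := wedge_mem_supported i hw
  refine mem_supported_of_contract_eq_zero i
    (sub_mem hz (totalDifferential_mem_supported x hw')) ?_
  rw [map_sub, contract_totalDifferential i x hw', contract_wedge i hw, h, sub_self]

/-! ### Degrees zero and one, where proregularity enters -/

theorem totalDifferential_empty (x : Fin k → R) (f : Finset (Fin k) → M) :
    totalDifferential M x f ∅ = ∑ j, x j • f {j} := by
  rw [totalDifferential_apply]
  refine Fintype.sum_equiv (Equiv.subtypeUnivEquiv fun j => Finset.notMem_empty j) _ _ fun j => ?_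
  simp [before, Equiv.subtypeUnivEquiv]

theorem exists_of_mem_initialPowers (x : Fin k → R) (i : Fin k) (n : ℕ) {a : M}
    (ha : a ∈ initialPowers M x i n) :
    ∃ w ∈ supported R M k i 1, totalDifferential M (powers x n) w ∅ = a := by
  have key : initialPowers M x i n ≤ (supported R M k i 1).map
      (LinearMap.proj ∅ ∘ₗ totalDifferential M (powers x n)) := by
    rw [initialPowers, Submodule.span_smul_eq, Submodule.set_smul_le_iff]
    rintro r b ⟨j, hj, rfl⟩ -
    -- The chain `b e_j` has boundary `x_j^n b`.
    refine ⟨Pi.single {j} b, fun S hS => ?_, ?_⟩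
    · rw [Pi.single_apply, if_neg]
      rintro rfl
      exact hS ⟨Finset.card_singleton j, by simpa using hj⟩
    · simp only [LinearMap.comp_apply, LinearMap.proj_apply, totalDifferential_empty]
      rw [Finset.sum_eq_single j]
      · simp [powers]
      · intro l _ hl
        simp [hl]
      · simp
  obtain ⟨w, hw, rfl⟩ := key ha
  exact ⟨w, hw, rfl⟩

/-- The cycle condition is the relation `∑ x_j^m z_j = 0`, solved for its last term. -/
theorem single_mem_colon_of_cycle (x : Fin k → R) (i : Fin k) (m : ℕ) {z : Finset (Fin k) → M}
    (hz : z ∈ supported R M k (i + 1) 1) (h : totalDifferential M (powers x m) z = 0) :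
    z {i} ∈ colon (initialPowers M x i m) (x i ^ m) := by
  have h0 := congrFun h ∅
  rw [totalDifferential_empty, ← Finset.add_sum_erase _ _ (Finset.mem_univ i)] at h0
  change x i ^ m • z {i} ∈ initialPowers M x i m
  rw [show x i ^ m • z {i} = _ from eq_neg_of_add_eq_zero_left h0]
  refine neg_mem (sum_mem fun j hj => ?_)
  rcases lt_or_gt_of_ne (Finset.ne_of_mem_erase hj) with hlt | hgt
  · exact Submodule.smul_mem_smul (Ideal.subset_span ⟨j, hlt, rfl⟩) Submodule.mem_top
  · rw [hz {j}, smul_zero]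
    · exact zero_mem _
    · rintro ⟨-, hS⟩
      have h1 := hS j (Finset.mem_singleton_self j)
      have h2 : i.val < j.val := hgt
      omega

/-! ### Induction on the length of the initial segment -/

/-- The image of a cycle on the first `i` elements, of positive degree, under a suitable
transition map is a boundary. -/
theorem exists_totalDifferential_eq (x : Fin k → R) (hx : IsProregular M x) (i : ℕ) (hi : i ≤ k)
    (p n : ℕ) (hn : 1 ≤ n) :
    ∃ m, n ≤ m ∧ ∀ z ∈ supported R M k i (p + 1), totalDifferential M (powers x m) z = 0 →
      ∃ w ∈ supported R M k i (p + 2),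
        totalDifferential M (powers x n) w = totalScale M (powers x (m - n)) z := by
  have powers_eq : ∀ {a b : ℕ}, a ≤ b → ∀ j, powers x b j = powers x (b - a) j * powers x a j :=
    fun hab j => by simp only [powers]; rw [← pow_add, Nat.sub_add_cancel hab]
  induction i generalizing p n with
  | zero =>
    refine ⟨n, le_rfl, fun z hz _ => ⟨0, zero_mem _, ?_⟩⟩
    have : z = 0 := funext fun S => hz S fun hS => by
      obtain ⟨j, hj⟩ := Finset.card_pos.1 (by rw [hS.1]; exact Nat.succ_pos p)
      exact Nat.not_lt_zero _ (hS.2 j hj)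
    rw [this, map_zero, map_zero]
  | succ i ih =>
    obtain ⟨l, hnl, hl⟩ := ih (Nat.le_of_succ_le hi) p n hn
    have hl1 : 1 ≤ l := hn.trans hnl
    let I : Fin k := ⟨i, hi⟩
    -- It is enough to kill the contraction between exponents `m` and `l`: subtracting the boundary
    -- of `w ∧ e_i` then leaves a cycle on `i` elements, which the choice of `l` kills at exponent
    -- `n`.
    suffices ∃ m, l ≤ m ∧ ∀ z ∈ supported R M k (i + 1) (p + 1),
        totalDifferential M (powers x m) z = 0 → ∃ w ∈ supported R M k i (p + 1),
          totalDifferential M (powers x l) w =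
            contract R M I (totalScale M (powers x (m - l)) z) by
      obtain ⟨m, hlm, hm⟩ := this
      refine ⟨m, hnl.trans hlm, fun z hz hdz => ?_⟩
      obtain ⟨w, hw, hdw⟩ := hm z hz hdz
      obtain ⟨w', hw', hdw'⟩ := hl _
        (sub_totalDifferential_wedge_mem_supported I _ (totalScale_mem_supported _ hz) hw hdw) (by
          rw [map_sub, totalDifferential_totalDifferential,
            totalDifferential_totalScale _ _ _ (powers_eq hlm), hdz, map_zero, sub_zero])
      refine ⟨w' + totalScale M (powers x (l - n)) (wedge I w),
        add_mem (supported_mono (Nat.le_succ i) hw')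
          (totalScale_mem_supported _ (wedge_mem_supported I hw)), ?_⟩
      rw [map_add, hdw', totalDifferential_totalScale _ _ _ (powers_eq hnl), map_sub,
        sub_add_cancel, totalScale_totalScale]
      congr 2
      funext j
      simp only [powers]
      rw [← pow_add]
      congr 1
      omega
    cases p with
    | zero =>
      -- The contraction has degree `0`, where the inductive statement says nothing; proregularity
      -- replaces it.
      obtain ⟨m, hlm, hm⟩ := hx I l hl1
      refine ⟨m, hlm, fun z hz hdz => ?_⟩
      obtain ⟨w, hw, hdw⟩ := exists_of_mem_initialPowers x I l
        (hm (single_mem_colon_of_cycle x I m hz hdz))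
      refine ⟨w, hw, funext fun S => ?_⟩
      rcases S.eq_empty_or_nonempty with rfl | hS
      · rw [hdw]
        simp [contract_apply, totalScale_apply, powers]
      · have hc : ¬(S.card = 0 ∧ ∀ j ∈ S, j.val < i) := fun h => hS.card_pos.ne' h.1
        rw [totalDifferential_mem_supported _ hw S hc,
          contract_mem_supported I (totalScale_mem_supported _ hz) S hc]
    | succ p =>
      obtain ⟨m, hlm, hm⟩ := ih (Nat.le_of_succ_le hi) p l hl1
      refine ⟨m, hlm, fun z hz hdz => ?_⟩
      obtain ⟨w, hw, hdw⟩ := hm _ (contract_mem_supported I hz) (by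
        rw [← contract_totalDifferential I _ hz, hdz, map_zero])
      -- Scaling `e_S ∧ e_i` contributes an additional factor `x_i^{m-l}`, absorbed into the
      -- witness.
      exact ⟨powers x (m - l) I • w, Submodule.smul_mem _ _ hw, by
        rw [map_smul, hdw, contract_totalScale]⟩

theorem exists_differential_eq (x : Fin k → R) (hx : IsProregular M x) (p n : ℕ) (hn : 1 ≤ n) :
    ∃ m, n ≤ m ∧ ∀ z : Chains k (p + 1) M, differential M (powers x m) p z = 0 →
      ∃ w, differential M (powers x n) (p + 1) w = scale M (powers x (m - n)) (p + 1) z := by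
  obtain ⟨m, hnm, hm⟩ := exists_totalDifferential_eq x hx k le_rfl p n hn
  refine ⟨m, hnm, fun z hdz => ?_⟩
  -- Extension by zero to the other degrees keeps `z` a cycle.
  let f : Finset (Fin k) → M := fun S => if h : S.card = p + 1 then z ⟨S, h⟩ else 0
  have hf : f ∈ supported R M k k (p + 1) := fun S hS =>
    dif_neg fun h => hS ⟨h, fun j _ => j.2⟩
  have hfz : component (p + 1) f = z := funext fun S => dif_pos S.2
  obtain ⟨w, -, hw⟩ := hm f hf (funext fun S => by
    by_cases h : S.card = p
    · have := component_totalDifferential (powers x m) p f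
      rw [hfz, hdz] at this
      exact congrFun this ⟨S, h⟩
    · exact totalDifferential_mem_supported _ hf S fun hS => h hS.1)
  exact ⟨component (p + 2) w, by
    rw [← component_totalDifferential, hw, component_totalScale, hfz]⟩

end Koszul

/-! ### From cycles and boundaries to homology -/

/-- A chain map of complexes of modules that sends cycles to boundaries is zero on homology. -/
theorem ModuleCat.homologyMap_eq_zero {R : Type*} [Ring R] {K L : ChainComplex (ModuleCat R) ℕ}
    (φ : K ⟶ L) (p : ℕ)
    (h : ∀ z : K.X (p + 1), (K.d (p + 1) p).hom z = 0 →
      ∃ w : L.X (p + 1 + 1), (L.d (p + 1 + 1) (p + 1)).hom w = (φ.f (p + 1)).hom z) :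
    HomologicalComplex.homologyMap φ (p + 1) = 0 := by
  rw [← cancel_epi (K.homologyπ (p + 1)), HomologicalComplex.homologyπ_naturality,
    Limits.comp_zero]
  ext c
  obtain ⟨w, hw⟩ := h ((K.iCycles (p + 1)).hom c) (by
    rw [← ModuleCat.comp_apply, HomologicalComplex.iCycles_d]; rfl)
  -- Cycles embed in chains, so the equality may be checked there.
  have hc : (HomologicalComplex.cyclesMap φ (p + 1)).hom c = (L.toCycles (p + 2) (p + 1)).hom w := by
    apply (ModuleCat.mono_iff_injective (L.iCycles (p + 1))).1 inferInstance
    rw [← ModuleCat.comp_apply, ← ModuleCat.comp_apply, HomologicalComplex.cyclesMap_i,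
      HomologicalComplex.toCycles_i]
    exact hw.symm
  rw [ModuleCat.comp_apply, hc, ← ModuleCat.comp_apply, HomologicalComplex.toCycles_comp_homologyπ]
  rfl

end

theorem theorem2p4 {R : Type*} [CommRing R] {M : Type*} [AddCommGroup M] [Module R M]
    {k : ℕ} (x : Fin k → R) (hx : Koszul.IsProregular M x) :
    Koszul.IsWeaklyProregular M x := by
  intro i hi n hn
  obtain ⟨p, rfl⟩ := Nat.exists_eq_add_of_lt hi
  rw [zero_add]
  obtain ⟨m, hnm, hm⟩ := Koszul.exists_differential_eq x hx p n hn
  refine ⟨m, hnm, ModuleCat.homologyMap_eq_zero _ p fun z hz => ?_⟩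
  simp only [Koszul.complex, ChainComplex.of_d] at hz ⊢
  exact hm z hz
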